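/- Let $d \ge 2$ and let $\mathbb{S}^d$ be the unit sphere of $\mathbb{R}^{d+1}$. Let $\omega_d$ be the surface area of $\mathbb{S}^d$, let $\sigma_d$ be the surface area measure on $\mathbb{S}^d$ normalized to be a probability measure, and for $x \in \mathbb{S}^d$ and $t \in [-1,1]$ let $C(x,t) = \{ z \in \mathbb{S}^d : z \cdot x \ge t \}$. For points $x_1, \dots, x_N \in \mathbb{S}^d$ define the spherical cap $\mathbb{L}_2$-discrepancy $$D(x_1,\dots,x_N) = \sqrt{ \int_{-1}^1 \int_{\mathbb{S}^d} \left| \frac{ |\{ k : x_k \in C(x,t) \}| }{N} - \sigma_d(C(x,t)) \right|^2 \, d\sigma_d(x) \, dt },$$ and put $$C_d = \frac{1}{d} \, \frac{\omega_{d-1}}{\omega_d} = \frac{1}{d} \, \frac{\Gamma(\frac{d+1}{2})}{\sqrt{\pi} \, \Gamma(\frac{d}{2})}.$$ Then for every $N \ge 2$ and all $x_1, \dots, x_N \in \mathbb{S}^d$ (not necessarily distinct), $$D(x_1,\dots,x_N) \ \ge \ \sqrt{\frac{C_d}{\sqrt{2}}} \, \left\| \frac{1}{N} \sum_{j=1}^N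 x_j \right\|,$$ where $\|\cdot\|$ is the Euclidean norm. -/

import Mathlib

noncomputable section

namespace CapDiscrepancy

open MeasureTheory

/-- The unit sphere `S^d` in the Euclidean space `ℝ^(d+1)`. -/
abbrev UnitSphere (d : ℕ) : Type :=
  Metric.sphere (0 : EuclideanSpace ℝ (Fin (d + 1))) 1

/-- The surface area measure on `S^d` (not normalized), i.e. the measure that Lebesgue measure on
`ℝ^(d+1)` induces on the sphere through polar coordinates. -/
def surfaceMeasure (d : ℕ) : Measure (UnitSphere d) :=
  (volume : Measure (EuclideanSpace ℝ (Fin (d + 1)))).toSphere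

/-- The total surface area `ω_d` of `S^d`. -/
def surfaceArea (d : ℕ) : ℝ :=
  (surfaceMeasure d).real Set.univ

/-- The normalized surface area measure `σ_d` on `S^d`. -/
def uniformMeasure (d : ℕ) : Measure (UnitSphere d) :=
  (surfaceMeasure d Set.univ)⁻¹ • surfaceMeasure d

/-- The spherical cap `C(x, t) = {z ∈ S^d : z ⬝ x ≥ t}`. -/
def cap {d : ℕ} (x : UnitSphere d) (t : ℝ) : Set (UnitSphere d) :=
  {z | inner ℝ (z : EuclideanSpace ℝ (Fin (d + 1))) (x : EuclideanSpace ℝ (Fin (d + 1))) ≥ t}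

/-- The spherical cap `L₂`-discrepancy of the points `p 0, …, p (N - 1)` of `S^d`
(with repetitions counted). -/
def capDiscrepancy {d N : ℕ} (p : Fin N → UnitSphere d) : ℝ :=
  Real.sqrt (∫ t in (-1 : ℝ)..1, ∫ x : UnitSphere d,
    |(({k : Fin N | p k ∈ cap x t}.ncard : ℝ) / (N : ℝ)) - (uniformMeasure d).real (cap x t)| ^ 2
      ∂(uniformMeasure d))

/-- The constant `C_d = (1/d) ω_{d-1} / ω_d`, for `d ≥ 1`. -/
def stolarskyConstant (d : ℕ) : ℝ :=
  (1 / (d : ℝ)) * (surfaceArea (d - 1) / surfaceArea d)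

end CapDiscrepancy

end

/-! For a fixed height `t`, view the local discrepancy as a function of the cap centre `x` and keep
only its projection onto the degree one harmonics `x ↦ ⟨x, v⟩`. The measure of a cap does not see
that space, because it is even in `x`. The first moment of a cap around `y` is `C_d (1 - t²)^(d/2)
y`, so the counting term contributes the centroid `m` times `C_d (1 - t²)^(d/2)`. Bessel's
inequality then bounds the inner integral below by `(d + 1) C_d² (1 - t²)^d ‖m‖²`
(`le_integral_localDiscrepancy_sq`).

Integrating over `t` leaves the constant `(d + 1) C_d² ∫ (1 - t²)^d`. Wallis' bound `√(π / (d + 1))`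
for the integral and the bound `C_d ≥ 1 / √(2π(d + 1))`, from log-convexity of Gamma, reduce it to
`C_d / √2` (`stolarskyConstant_div_sqrt_two_le`).

The cap moment (`integral_cap_pole`) comes from a Gaussian integral over the cone on the cap,
evaluated both in polar and in product coordinates. -/

noncomputable section

namespace CapDiscrepancy

open MeasureTheory
open scoped Pointwise

/-! ### Rotation invariance, polar coordinates and moments on the unit sphere. -/

section Sphere

variable {E : Type*} [NormedAddCommGroup E] [InnerProductSpace ℝ E]

/-- The action of a linear isometry on the unit sphere. -/
def sphereMap (L : E ≃ₗᵢ[ℝ] E) (x : Metric.sphere (0 : E) 1) : Metric.sphere (0 : E) 1 :=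
  ⟨L x, by simp⟩

@[simp]
theorem coe_sphereMap (L : E ≃ₗᵢ[ℝ] E) (x : Metric.sphere (0 : E) 1) :
    (sphereMap L x : E) = L x := rfl

theorem exists_linearIsometryEquiv_apply_eq {x y : E} (h : ‖x‖ = ‖y‖) :
    ∃ L : E ≃ₗᵢ[ℝ] E, L x = y :=
  ⟨_, Submodule.reflection_sub h⟩

variable [FiniteDimensional ℝ E] [MeasurableSpace E] [BorelSpace E]

/-- The surface measure of `s` is a multiple of the volume of the cone `(0, 1) • s`; `L` commutes
with scaling and preserves volume. -/
theorem measurePreserving_sphereMap (L : E ≃ₗᵢ[ℝ] E) :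
    MeasurePreserving (sphereMap L) (volume : Measure E).toSphere
      (volume : Measure E).toSphere := by
  have hm : Measurable (sphereMap L) :=
    (L.continuous.measurable.comp measurable_subtype_coe).subtype_mk
  refine ⟨hm, Measure.ext fun s hs => ?_⟩
  rw [Measure.map_apply hm hs, Measure.toSphere_apply' _ (hm hs), Measure.toSphere_apply' _ hs]
  congr 1
  rw [← L.measurePreserving.measure_preimage_emb L.toMeasurableEquiv.measurableEmbedding
    (Set.Ioo (0 : ℝ) 1 • ((↑) '' s : Set E))]
  congr 1
  ext x
  simp only [Set.mem_smul, Set.mem_image, Set.mem_preimage, Subtype.exists]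
  constructor
  · rintro ⟨r, hr, _, ⟨u, hu, hus, rfl⟩, rfl⟩
    exact ⟨r, hr, L u, ⟨L u, by simpa using hu, hus, rfl⟩, by simp⟩
  · rintro ⟨r, hr, _, ⟨u, hu, hus, rfl⟩, hx⟩
    refine ⟨r, hr, L.symm u, ⟨L.symm u, by simpa using hu, ?_, rfl⟩, ?_⟩
    · have : sphereMap L ⟨L.symm u, by simpa using hu⟩ = ⟨u, hu⟩ := by ext; simp
      rwa [this]
    · apply L.injective
      simpa using hx

theorem integral_comp_sphereMap (L : E ≃ₗᵢ[ℝ] E) {f : Metric.sphere (0 : E) 1 → ℝ}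
    (hf : Measurable f) :
    ∫ x, f (sphereMap L x) ∂(volume : Measure E).toSphere
      = ∫ x, f x ∂(volume : Measure E).toSphere := by
  have h := measurePreserving_sphereMap L
  rw [← h.map_eq, integral_map h.measurable.aemeasurable hf.aestronglyMeasurable, h.map_eq]

/-- Polar coordinates for a product of a radial weight and a function of the direction. -/
theorem integral_polar [Nontrivial E] (f : Metric.sphere (0 : E) 1 → ℝ) (g : ℝ → ℝ) (F : E → ℝ)
    (hF : ∀ x : E, ∀ u : Metric.sphere (0 : E) 1, (u : E) = ‖x‖⁻¹ • x → F x = f u * g ‖x‖) :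
    ∫ x, F x = (∫ u, f u ∂(volume : Measure E).toSphere) *
      ∫ r in Set.Ioi (0 : ℝ), r ^ (Module.finrank ℝ E - 1) * g r := by
  have hr : ∫ r : Set.Ioi (0 : ℝ), g r ∂Measure.volumeIoiPow (Module.finrank ℝ E - 1)
      = ∫ r in Set.Ioi (0 : ℝ), r ^ (Module.finrank ℝ E - 1) * g r := by
    simp only [Measure.volumeIoiPow, ENNReal.ofReal]
    rw [integral_withDensity_eq_integral_smul
      ((measurable_subtype_coe.pow_const _).real_toNNReal),
      integral_subtype_comap measurableSet_Ioi
        fun a ↦ Real.toNNReal (a ^ (Module.finrank ℝ E - 1)) • g a,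
      setIntegral_congr_fun measurableSet_Ioi fun x hx ↦ ?_]
    rw [NNReal.smul_def, Real.coe_toNNReal _ (pow_nonneg hx.out.le _), smul_eq_mul]
  calc ∫ x, F x = ∫ x : ({0}ᶜ : Set E), F x ∂((volume : Measure E).comap (↑)) := by
        rw [integral_subtype_comap (measurableSet_singleton _).compl F, restrict_compl_singleton]
    _ = ∫ x : ({0}ᶜ : Set E), (fun z : Metric.sphere (0 : E) 1 × Set.Ioi (0 : ℝ) => f z.1 * g z.2)
          (homeomorphUnitSphereProd E x) ∂((volume : Measure E).comap (↑)) := by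
        refine integral_congr_ae (.of_forall fun x => ?_)
        simp only [homeomorphUnitSphereProd_apply_snd_coe]
        exact hF _ _ (homeomorphUnitSphereProd_apply_fst_coe E x)
    _ = _ := by
        refine (Measure.measurePreserving_homeomorphUnitSphereProd
          (volume : Measure E)).integral_comp (homeomorphUnitSphereProd E).measurableEmbedding
          (fun z => f z.1 * g z.2) |>.trans ?_
        rw [← hr]
        exact integral_prod_mul f (fun r : Set.Ioi (0 : ℝ) => g r)

theorem integrable_inner_toSphere (v : E) {s : Set (Metric.sphere (0 : E) 1)}
    (hs : MeasurableSet s) :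
    Integrable (s.indicator fun x : Metric.sphere (0 : E) 1 => inner ℝ (x : E) v)
      (volume : Measure E).toSphere := by
  refine Integrable.indicator (Integrable.of_bound (C := ‖v‖)
    (by fun_prop) (.of_forall fun x => ?_)) hs
  simpa using norm_inner_le_norm (𝕜 := ℝ) (x : E) v

/-- By rotation invariance `v` may be replaced by any `‖v‖ • b i`; summing over an orthonormal
basis, Parseval makes the integrand constant. -/
theorem integral_inner_sq_toSphere (v : E) :
    (Module.finrank ℝ E : ℝ) *
        ∫ x : Metric.sphere (0 : E) 1, inner ℝ (x : E) v ^ 2 ∂(volume : Measure E).toSphere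
      = ‖v‖ ^ 2 * (volume : Measure E).toSphere.real Set.univ := by
  set μ := (volume : Measure E).toSphere
  have key : ∀ w : E, ‖w‖ = ‖v‖ → ∫ x : Metric.sphere (0 : E) 1, inner ℝ (x : E) w ^ 2 ∂μ
      = ∫ x : Metric.sphere (0 : E) 1, inner ℝ (x : E) v ^ 2 ∂μ := by
    intro w hw
    obtain ⟨L, hL⟩ := exists_linearIsometryEquiv_apply_eq hw
    rw [← integral_comp_sphereMap L (f := fun x => inner ℝ (x : E) v ^ 2) (by fun_prop), ← hL]
    simp [μ]
  let b := stdOrthonormalBasis ℝ E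
  have hint : ∀ i, Integrable
      (fun x : Metric.sphere (0 : E) 1 => inner ℝ (x : E) (‖v‖ • b i) ^ 2) μ := by
    intro i
    refine Integrable.of_bound (C := ‖v‖ ^ 2) (by fun_prop) (.of_forall fun x => ?_)
    have h := abs_real_inner_le_norm (x : E) (‖v‖ • b i)
    rw [norm_smul] at h
    simp only [norm_eq_of_mem_sphere, b.norm_eq_one, norm_norm, mul_one, one_mul] at h
    rw [norm_pow, Real.norm_eq_abs]
    gcongr
  calc (Module.finrank ℝ E : ℝ) * ∫ x : Metric.sphere (0 : E) 1, inner ℝ (x : E) v ^ 2 ∂μ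
      = ∑ i, ∫ x : Metric.sphere (0 : E) 1, inner ℝ (x : E) (‖v‖ • b i) ^ 2 ∂μ := by
        rw [Finset.sum_congr rfl fun i _ => key _ (by simp [norm_smul])]
        simp
    _ = ∫ x : Metric.sphere (0 : E) 1, ‖v‖ ^ 2 ∂μ := by
        rw [← integral_finsetSum _ fun i _ => hint i]
        congr 1 with x
        have h := b.sum_sq_inner_right (x : E)
        simp only [norm_eq_of_mem_sphere] at h
        simp only [real_inner_smul_right, mul_pow, ← Finset.mul_sum]
        simp only [fun i => real_inner_comm (b i) (x : E), h]
        simp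
    _ = _ := by simp [mul_comm]

/-- The first moment of a cap points in the direction of its centre. -/
theorem integral_cap_inner_toSphere (y v : E) (hy : ‖y‖ = 1) (t : ℝ) :
    ∫ x, {x : Metric.sphere (0 : E) 1 | t ≤ inner ℝ (x : E) y}.indicator
        (fun x => inner ℝ (x : E) v) x ∂(volume : Measure E).toSphere
      = inner ℝ y v * ∫ x, {x : Metric.sphere (0 : E) 1 | t ≤ inner ℝ (x : E) y}.indicator
        (fun x => inner ℝ (x : E) y) x ∂(volume : Measure E).toSphere := by
  set s := {x : Metric.sphere (0 : E) 1 | t ≤ inner ℝ (x : E) y}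
  have hs : MeasurableSet s := measurableSet_le measurable_const (by fun_prop)
  -- The reflection in the line `ℝ y` preserves the cap and negates the component orthogonal to `y`,
  -- which therefore integrates to zero.
  set R := (ℝ ∙ y).reflection
  have hRy : R y = y := Submodule.reflection_mem_subspace_eq_self (Submodule.mem_span_singleton_self y)
  have hR : ∀ x, R x = (2 * inner ℝ x y) • y - x := by
    intro x
    rw [Submodule.reflection_apply, Submodule.starProjection_unit_singleton ℝ hy, real_inner_comm,
      two_smul, two_mul, add_smul]
  have hinv : ∀ x : E, inner ℝ (R x) y = inner ℝ x y := by
    intro x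
    conv_lhs => rw [← hRy]
    exact R.inner_map_map x y
  have h1 := integral_comp_sphereMap R (f := s.indicator fun x => inner ℝ (x : E) v)
    (Measurable.indicator (by fun_prop) hs)
  have h2 : ∀ x, s.indicator (fun x : Metric.sphere (0 : E) 1 => inner ℝ (x : E) v) (sphereMap R x)
      = 2 * inner ℝ y v * s.indicator (fun x => inner ℝ (x : E) y) x
        - s.indicator (fun x => inner ℝ (x : E) v) x := by
    intro x
    have : sphereMap R x ∈ s ↔ x ∈ s := by simp [s, hinv]
    by_cases hx : x ∈ s
    · rw [Set.indicator_of_mem (this.2 hx), Set.indicator_of_mem hx, Set.indicator_of_mem hx,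
        coe_sphereMap, hR, inner_sub_left, real_inner_smul_left]
      ring
    · rw [Set.indicator_of_notMem (mt this.1 hx), Set.indicator_of_notMem hx,
        Set.indicator_of_notMem hx]
      ring
  simp only [h2] at h1
  rw [integral_sub ((integrable_inner_toSphere y hs).const_mul _) (integrable_inner_toSphere v hs),
    integral_const_mul] at h1
  linarith

theorem integral_cap_inner_self_toSphere_eq {y z : E} (h : ‖y‖ = ‖z‖) (t : ℝ) :
    ∫ x, {x : Metric.sphere (0 : E) 1 | t ≤ inner ℝ (x : E) y}.indicator
        (fun x => inner ℝ (x : E) y) x ∂(volume : Measure E).toSphere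
      = ∫ x, {x : Metric.sphere (0 : E) 1 | t ≤ inner ℝ (x : E) z}.indicator
        (fun x => inner ℝ (x : E) z) x ∂(volume : Measure E).toSphere := by
  obtain ⟨L, rfl⟩ := exists_linearIsometryEquiv_apply_eq h
  rw [← integral_comp_sphereMap L (f := {x : Metric.sphere (0 : E) 1 |
    t ≤ inner ℝ (x : E) (L y)}.indicator fun x => inner ℝ (x : E) (L y))
    (Measurable.indicator (by fun_prop) (measurableSet_le measurable_const (by fun_prop)))]
  simp [Set.indicator]

end Sphere

/-! ### Gaussian moment of a circular cone. -/

theorem integral_Ioi_mul_exp_neg_sq (k : ℝ) :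
    ∫ s in Set.Ioi k, s * Real.exp (-s ^ 2) = Real.exp (-k ^ 2) / 2 := by
  have hd : ∀ x : ℝ, HasDerivAt (fun s : ℝ => -(Real.exp (-s ^ 2) / 2))
      (x * Real.exp (-x ^ 2)) x := by
    intro x
    convert! (((hasDerivAt_pow 2 x).neg.exp).div_const 2).neg using 1
    simp
    ring
  have hi : Integrable fun s : ℝ => s * Real.exp (-s ^ 2) := by
    simpa using integrable_mul_exp_neg_mul_sq one_pos
  have hl : Filter.Tendsto (fun s : ℝ => -(Real.exp (-s ^ 2) / 2)) Filter.atTop (nhds 0) := by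
    have := (Real.tendsto_exp_neg_atTop_nhds_zero.comp
      (Filter.tendsto_pow_atTop (α := ℝ) two_ne_zero)).div_const 2 |>.neg
    simpa [Function.comp_def] using this
  rw [integral_Ioi_of_hasDerivAt_of_tendsto (hd k).continuousAt.continuousWithinAt
    (fun x _ => hd x) hi.integrableOn hl]
  ring

/-- With `t = cos θ` the slope is `cot θ`: each slice of the cone at fixed `b` is a half-line in
`s`. Squaring needs matching signs, hence the four cases. -/
theorem cone_iff {t s b : ℝ} (ht : t ^ 2 < 1) (hb : 0 ≤ b) :
    t * √(s ^ 2 + b ^ 2) ≤ s ↔ t / √(1 - t ^ 2) * b ≤ s := by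
  have hc : 0 < √(1 - t ^ 2) := Real.sqrt_pos.2 (by linarith)
  have hc2 : √(1 - t ^ 2) ^ 2 = 1 - t ^ 2 := Real.sq_sqrt (by linarith)
  have hR : 0 ≤ √(s ^ 2 + b ^ 2) := Real.sqrt_nonneg _
  have hR2 : √(s ^ 2 + b ^ 2) ^ 2 = s ^ 2 + b ^ 2 := Real.sq_sqrt (by positivity)
  set c := √(1 - t ^ 2)
  set R := √(s ^ 2 + b ^ 2)
  rw [div_mul_eq_mul_div, div_le_iff₀ hc]
  rcases le_or_gt 0 t with h0 | h0 <;> rcases le_or_gt 0 s with h1 | h1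
  · rw [← sq_le_sq₀ (by positivity) h1, ← sq_le_sq₀ (by positivity : 0 ≤ t * b) (by positivity),
      mul_pow, mul_pow, mul_pow, hR2, hc2]
    constructor <;> intro h <;> linarith
  · have h2 : s * c < 0 := mul_neg_of_neg_of_pos h1 hc
    have h3 : 0 ≤ t * R := by positivity
    have h4 : 0 ≤ t * b := by positivity
    constructor <;> intro h <;> linarith
  · have h2 : 0 ≤ s * c := by positivity
    have h3 : t * R ≤ 0 := mul_nonpos_of_nonpos_of_nonneg h0.le hR
    have h4 : t * b ≤ 0 := mul_nonpos_of_nonpos_of_nonneg h0.le hb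
    constructor <;> intro h <;> linarith
  · have e1 : t * R ≤ s ↔ -s ≤ -t * R := by constructor <;> intro h <;> linarith
    have e2 : t * b ≤ s * c ↔ -s * c ≤ -t * b := by constructor <;> intro h <;> linarith
    rw [e1, e2, ← sq_le_sq₀ (by linarith) (mul_nonneg (by linarith) hR),
      ← sq_le_sq₀ (mul_nonneg (by linarith) hc.le) (mul_nonneg (by linarith) hb),
      mul_pow, mul_pow, mul_pow, hR2, hc2]
    constructor <;> intro h <;> linarith

/-- The Gaussian first moment of a circular cone in `ℝ × V`. -/
theorem integral_cone_gaussian {V : Type*} [NormedAddCommGroup V] [InnerProductSpace ℝ V]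
    [FiniteDimensional ℝ V] [MeasurableSpace V] [BorelSpace V] {t : ℝ} (ht : t ^ 2 < 1) :
    ∫ z : ℝ × V, {z : ℝ × V | t * √(z.1 ^ 2 + ‖z.2‖ ^ 2) ≤ z.1}.indicator
        (fun z => z.1 * Real.exp (-(z.1 ^ 2 + ‖z.2‖ ^ 2))) z
      = (Real.pi * (1 - t ^ 2)) ^ ((Module.finrank ℝ V : ℝ) / 2) / 2 := by
  have hV : Integrable fun w : V => Real.exp (-‖w‖ ^ 2) := by
    refine Integrable.of_integral_ne_zero ?_
    have := GaussianFourier.integral_rexp_neg_mul_sq_norm (V := V) one_pos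
    simp only [neg_mul, one_mul] at this
    rw [this]
    positivity
  have hS : Integrable fun s : ℝ => s * Real.exp (-s ^ 2) := by
    simpa using integrable_mul_exp_neg_mul_sq one_pos
  have hprod : ∀ z : ℝ × V, z.1 * Real.exp (-(z.1 ^ 2 + ‖z.2‖ ^ 2))
      = z.1 * Real.exp (-z.1 ^ 2) * Real.exp (-‖z.2‖ ^ 2) := by
    intro z
    rw [neg_add, Real.exp_add, mul_assoc]
  have hmeas : MeasurableSet {z : ℝ × V | t * √(z.1 ^ 2 + ‖z.2‖ ^ 2) ≤ z.1} :=
    measurableSet_le (by fun_prop) (by fun_prop)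
  have hint : Integrable ({z : ℝ × V | t * √(z.1 ^ 2 + ‖z.2‖ ^ 2) ≤ z.1}.indicator
      (fun z => z.1 * Real.exp (-(z.1 ^ 2 + ‖z.2‖ ^ 2)))) := by
    refine Integrable.indicator ?_ hmeas
    simp only [hprod]
    exact hS.mul_prod hV
  have hpos : 0 < 1 - t ^ 2 := by linarith
  set κ := t / √(1 - t ^ 2) with hκ
  have hκ2 : 1 + κ ^ 2 = 1 / (1 - t ^ 2) := by
    rw [hκ, div_pow, Real.sq_sqrt hpos.le]
    field_simp
    ring
  rw [Measure.volume_eq_prod] at hint ⊢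
  rw [integral_prod_symm _ hint]
  have inner_eq : ∀ w : V, ∫ s : ℝ, {z : ℝ × V | t * √(z.1 ^ 2 + ‖z.2‖ ^ 2) ≤ z.1}.indicator
        (fun z => z.1 * Real.exp (-(z.1 ^ 2 + ‖z.2‖ ^ 2))) (s, w)
      = Real.exp (-(1 + κ ^ 2) * ‖w‖ ^ 2) / 2 := by
    intro w
    have : ∀ s : ℝ, {z : ℝ × V | t * √(z.1 ^ 2 + ‖z.2‖ ^ 2) ≤ z.1}.indicator
        (fun z => z.1 * Real.exp (-(z.1 ^ 2 + ‖z.2‖ ^ 2))) (s, w)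
        = (Set.Ici (κ * ‖w‖)).indicator (fun s => s * Real.exp (-s ^ 2)) s
          * Real.exp (-‖w‖ ^ 2) := by
      intro s
      have e : s * Real.exp (-(s ^ 2 + ‖w‖ ^ 2)) = s * Real.exp (-s ^ 2) * Real.exp (-‖w‖ ^ 2) :=
        hprod (s, w)
      simp only [Set.indicator, Set.mem_ofPred_eq, Set.mem_Ici, cone_iff ht (norm_nonneg w), e,
        ite_mul, zero_mul, hκ]
    simp only [this]
    rw [integral_mul_const, integral_indicator measurableSet_Ici, integral_Ici_eq_integral_Ioi,
      integral_Ioi_mul_exp_neg_sq, div_mul_eq_mul_div, ← Real.exp_add]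
    ring_nf
  simp only [inner_eq]
  rw [integral_div, GaussianFourier.integral_rexp_neg_mul_sq_norm (by rw [hκ2]; positivity), hκ2]
  simp

/-! ### Bounds for the constants. -/

/-- Wallis' lower bound. -/
theorem sqrt_le_integral_one_sub_sq_pow (d : ℕ) :
    √(Real.pi / (d + 1)) ≤ ∫ t in (-1 : ℝ)..1, (1 - t ^ 2) ^ d := by
  -- The substitution `t = cos x` gives the integral of `sin ^ (2d + 1)`. Sine integrals decrease
  -- with the exponent, so its square is at least the product of two consecutive ones, which is
  -- exactly `π / (d + 1)`.
  have h0 := integral_sin_pow_odd_mul_cos_pow (a := 0) (b := Real.pi) d 0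
  simp only [pow_zero, mul_one, one_mul, Real.cos_pi, Real.cos_zero] at h0
  rw [← h0]
  have hle := integral_sin_pow_succ_le (2 * d + 1)
  have hpos := integral_sin_pow_pos (2 * d + 1)
  have hprod : (∫ x in 0..Real.pi, Real.sin x ^ (2 * d + 1)) *
      (∫ x in 0..Real.pi, Real.sin x ^ (2 * d + 1 + 1)) = Real.pi / (d + 1) := by
    rw [show 2 * d + 1 + 1 = 2 * (d + 1) by ring, integral_sin_pow_odd, integral_sin_pow_even]
    clear h0 hle hpos
    induction d with
    | zero => simp; ring
    | succ n ih =>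
      rw [Finset.prod_range_succ, Finset.prod_range_succ _ (n + 1)]
      have : ∀ a b x y : ℝ, 2 * (a * x) * (Real.pi * (b * y)) =
        (2 * a * (Real.pi * b)) * (x * y) := by intros; ring
      rw [this, ih]
      push_cast
      field_simp
      ring
  refine Real.sqrt_le_iff.2 ⟨hpos.le, ?_⟩
  rw [← hprod, sq]
  gcongr

/-- Log-convexity of Gamma at the midpoint of `x` and `x + 1`. -/
theorem Gamma_add_half_le {x : ℝ} (hx : 0 < x) :
    Real.Gamma (x + 1 / 2) ≤ √x * Real.Gamma x := by
  have h := Real.Gamma_mul_add_mul_le_rpow_Gamma_mul_rpow_Gamma hx (by linarith : 0 < x + 1)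
    (by norm_num : (0 : ℝ) < 1 / 2) (by norm_num : (0 : ℝ) < 1 / 2) (by norm_num)
  have hG := Real.Gamma_pos_of_pos hx
  rw [Real.Gamma_add_one hx.ne', ← Real.mul_rpow hG.le (by positivity), ← Real.sqrt_eq_rpow] at h
  calc _ = Real.Gamma (1 / 2 * x + 1 / 2 * (x + 1)) := by ring_nf
    _ ≤ _ := h
    _ = √(x * Real.Gamma x ^ 2) := by ring_nf
    _ = _ := by rw [Real.sqrt_mul hx.le, Real.sqrt_sq hG.le]

theorem volume_real_unitBall {n : ℕ} (hn : 0 < n) :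
    volume.real (Metric.ball (0 : EuclideanSpace ℝ (Fin n)) 1)
      = √Real.pi ^ n / Real.Gamma (n / 2 + 1) := by
  have : Nonempty (Fin n) := ⟨⟨0, hn⟩⟩
  rw [Measure.real, EuclideanSpace.volume_ball]
  have : 0 < Real.Gamma ((n : ℝ) / 2 + 1) := Real.Gamma_pos_of_pos (by positivity)
  simp only [ENNReal.ofReal_one, one_pow, one_mul, Fintype.card_fin]
  rw [ENNReal.toReal_ofReal (by positivity)]

theorem surfaceArea_eq (d : ℕ) : surfaceArea d
    = (d + 1) * volume.real (Metric.ball (0 : EuclideanSpace ℝ (Fin (d + 1))) 1) := by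
  simp [surfaceArea, surfaceMeasure]

theorem surfaceArea_pos (d : ℕ) : 0 < surfaceArea d := by
  rw [surfaceArea_eq, volume_real_unitBall (Nat.succ_pos d)]
  have : 0 < Real.Gamma (((d + 1 : ℕ) : ℝ) / 2 + 1) := Real.Gamma_pos_of_pos (by positivity)
  positivity

theorem stolarskyConstant_eq {d : ℕ} (hd : 0 < d) : stolarskyConstant d
    = volume.real (Metric.ball (0 : EuclideanSpace ℝ (Fin d)) 1) / surfaceArea d := by
  obtain ⟨k, rfl⟩ := Nat.exists_eq_succ_of_ne_zero hd.ne'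
  simp only [Nat.succ_eq_add_one]
  have := surfaceArea_pos (k + 1)
  rw [stolarskyConstant, Nat.add_sub_cancel, surfaceArea_eq k]
  push_cast
  field_simp

theorem stolarskyConstant_pos {d : ℕ} (hd : 0 < d) : 0 < stolarskyConstant d := by
  rw [stolarskyConstant_eq hd, volume_real_unitBall hd]
  have : 0 < Real.Gamma ((d : ℝ) / 2 + 1) := Real.Gamma_pos_of_pos (by positivity)
  have := surfaceArea_pos d
  positivity

/-- The constant equals `Γ((d+1)/2) / (2 √π Γ(d/2+1))`, and `Gamma_add_half_le` at `(d+1)/2`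
controls the quotient. -/
theorem le_stolarskyConstant {d : ℕ} (hd : 0 < d) :
    1 / √(2 * Real.pi * (d + 1)) ≤ stolarskyConstant d := by
  rw [stolarskyConstant_eq hd, surfaceArea_eq, volume_real_unitBall hd,
    volume_real_unitBall (Nat.succ_pos d)]
  have h := Gamma_add_half_le (x := ((d : ℝ) + 1) / 2) (by positivity)
  have h1 : Real.Gamma (((d + 1 : ℕ) : ℝ) / 2 + 1)
      = ((d : ℝ) + 1) / 2 * Real.Gamma (((d : ℝ) + 1) / 2) := by
    push_cast
    rw [Real.Gamma_add_one (by positivity)]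
  rw [show ((d : ℝ) + 1) / 2 + 1 / 2 = d / 2 + 1 by ring] at h
  have h2 : 0 < Real.Gamma ((d : ℝ) / 2 + 1) := Real.Gamma_pos_of_pos (by positivity)
  have h3 : 0 < Real.Gamma (((d : ℝ) + 1) / 2) := Real.Gamma_pos_of_pos (by positivity)
  rw [h1]
  set G := Real.Gamma (((d : ℝ) + 1) / 2)
  set H := Real.Gamma ((d : ℝ) / 2 + 1)
  have hp : 0 < √Real.pi := Real.sqrt_pos.2 Real.pi_pos
  have e : √Real.pi ^ d / H / ((d + 1) * (√Real.pi ^ (d + 1) / ((d + 1) / 2 * G)))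
      = G / (2 * √Real.pi * H) := by
    rw [pow_succ]
    field_simp
  have e2 : √(2 * Real.pi * (d + 1)) = 2 * √Real.pi * √(((d : ℝ) + 1) / 2) := by
    rw [show 2 * Real.pi * ((d : ℝ) + 1) = 2 ^ 2 * Real.pi * (((d : ℝ) + 1) / 2) by ring,
      Real.sqrt_mul (by positivity), Real.sqrt_mul (by positivity), Real.sqrt_sq (by norm_num)]
  rw [e, e2, div_le_div_iff₀ (by positivity) (by positivity)]
  nlinarith [mul_le_mul_of_nonneg_left h (by positivity : 0 ≤ 2 * √Real.pi)]

/-- The degree one term of the discrepancy dominates `C_d / √2`. -/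
theorem stolarskyConstant_div_sqrt_two_le {d : ℕ} (hd : 0 < d) :
    stolarskyConstant d / √2
      ≤ (d + 1) * stolarskyConstant d ^ 2 * ∫ t in (-1 : ℝ)..1, (1 - t ^ 2) ^ d := by
  have hC := stolarskyConstant_pos hd
  -- The two lower bounds multiply to exactly this; it is the source of the `√2`.
  have e : 1 / √2 = (d + 1) * (1 / √(2 * Real.pi * (d + 1)) * √(Real.pi / (d + 1))) := by
    have hp : 0 < √Real.pi := Real.sqrt_pos.2 Real.pi_pos
    have hq : √((d : ℝ) + 1) ^ 2 = d + 1 := Real.sq_sqrt (by positivity)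
    have hq0 : 0 < √((d : ℝ) + 1) := Real.sqrt_pos.2 (by positivity)
    rw [Real.sqrt_mul (by positivity), Real.sqrt_mul (by positivity),
      Real.sqrt_div (by positivity)]
    field_simp
    exact hq
  calc stolarskyConstant d / √2 = stolarskyConstant d * (1 / √2) := by ring
    _ ≤ stolarskyConstant d * ((d + 1) * (stolarskyConstant d *
        ∫ t in (-1 : ℝ)..1, (1 - t ^ 2) ^ d)) := by
      rw [e]
      gcongr
      · exact le_stolarskyConstant hd
      · exact sqrt_le_integral_one_sub_sq_pow d
    _ = _ := by ring

/-! ### First moment of a cap in its own direction. -/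

theorem exists_pole (d : ℕ) : ∃ (e : EuclideanSpace ℝ (Fin (d + 1)))
    (Φ : WithLp 2 (ℝ × EuclideanSpace ℝ (Fin d)) ≃ₗᵢ[ℝ] EuclideanSpace ℝ (Fin (d + 1))),
    ‖e‖ = 1 ∧ ∀ z : ℝ × EuclideanSpace ℝ (Fin d),
      inner ℝ (Φ (WithLp.toLp 2 z)) e = z.1 ∧ ‖Φ (WithLp.toLp 2 z)‖ ^ 2 = z.1 ^ 2 + ‖z.2‖ ^ 2 := by
  have hdim : Module.finrank ℝ (WithLp 2 (ℝ × EuclideanSpace ℝ (Fin d)))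
      = Module.finrank ℝ (EuclideanSpace ℝ (Fin (d + 1))) := by
    simp [← LinearEquiv.finrank_eq (WithLp.linearEquiv 2 ℝ (ℝ × EuclideanSpace ℝ (Fin d))).symm,
      add_comm]
  let Φ := (stdOrthonormalBasis ℝ (WithLp 2 (ℝ × EuclideanSpace ℝ (Fin d)))).equiv
    (stdOrthonormalBasis ℝ (EuclideanSpace ℝ (Fin (d + 1)))) (finCongr hdim)
  refine ⟨Φ (WithLp.toLp 2 (1, 0)), Φ, ?_, fun z => ⟨?_, ?_⟩⟩
  · rw [LinearIsometryEquiv.norm_map]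
    simp
  · rw [LinearIsometryEquiv.inner_map_map]
    simp
  · rw [LinearIsometryEquiv.norm_map, WithLp.prod_norm_sq_eq_of_L2]
    simp

/-- The Gaussian moment of the cone is the cap moment times `Γ(d/2+1) / 2` in polar coordinates, and
`(π(1-t²))^(d/2) / 2` in product coordinates. The quotient `π^(d/2) / Γ(d/2+1)` is the volume of the
unit ball of `ℝ^d`, that is `ω_d C_d`. -/
theorem integral_cap_pole {d : ℕ} (hd : 0 < d) {t : ℝ} (ht : t ^ 2 < 1)
    {y : EuclideanSpace ℝ (Fin (d + 1))} (hy : ‖y‖ = 1) :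
    ∫ x, {x : UnitSphere d | t ≤ inner ℝ (x : EuclideanSpace ℝ (Fin (d + 1))) y}.indicator
        (fun x => inner ℝ (x : EuclideanSpace ℝ (Fin (d + 1))) y) x ∂surfaceMeasure d
      = surfaceArea d * stolarskyConstant d * (1 - t ^ 2) ^ ((d : ℝ) / 2) := by
  obtain ⟨e, Φ, he, hΦ⟩ := exists_pole d
  rw [surfaceMeasure, integral_cap_inner_self_toSphere_eq (hy.trans he.symm)]
  set A := ∫ x, {x : UnitSphere d | t ≤ inner ℝ (x : EuclideanSpace ℝ (Fin (d + 1))) e}.indicator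
        (fun x => inner ℝ (x : EuclideanSpace ℝ (Fin (d + 1))) e) x
        ∂(volume : Measure (EuclideanSpace ℝ (Fin (d + 1)))).toSphere with hA
  set F : EuclideanSpace ℝ (Fin (d + 1)) → ℝ :=
    {x | t * ‖x‖ ≤ inner ℝ x e}.indicator fun x => inner ℝ x e * Real.exp (-‖x‖ ^ 2) with hF
  have hpolar := integral_polar
    ({x : UnitSphere d | t ≤ inner ℝ (x : EuclideanSpace ℝ (Fin (d + 1))) e}.indicator
        fun x => inner ℝ (x : EuclideanSpace ℝ (Fin (d + 1))) e)
    (fun r => r * Real.exp (-r ^ 2)) F (by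
      intro x u hu
      rcases eq_or_ne x 0 with rfl | hx
      · simp [hF]
      have hx : 0 < ‖x‖ := norm_pos_iff.2 hx
      have hxu : inner ℝ x e = inner ℝ (u : EuclideanSpace ℝ (Fin (d + 1))) e * ‖x‖ := by
        rw [hu, real_inner_smul_left]
        field_simp
      simp only [hF, Set.indicator, Set.mem_ofPred_eq, hxu, mul_le_mul_iff_left₀ hx]
      split_ifs <;> ring)
  have hgauss : ∫ x, F x = (Real.pi * (1 - t ^ 2)) ^ ((d : ℝ) / 2) / 2 := by
    have hmp := Φ.measurePreserving.comp
      (WithLp.volume_preserving_toLp ℝ (EuclideanSpace ℝ (Fin d)))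
    have hFm : Measurable F :=
      Measurable.indicator (by fun_prop) (measurableSet_le (by fun_prop) (by fun_prop))
    rw [← hmp.map_eq, integral_map hmp.measurable.aemeasurable hFm.aestronglyMeasurable]
    have h := integral_cone_gaussian (V := EuclideanSpace ℝ (Fin d)) ht
    rw [finrank_euclideanSpace_fin] at h
    rw [← h]
    refine integral_congr_ae (.of_forall fun z => ?_)
    obtain ⟨h1, h2⟩ := hΦ z
    have h3 : ‖Φ (WithLp.toLp 2 z)‖ = √(z.1 ^ 2 + ‖z.2‖ ^ 2) := by
      rw [← h2, Real.sqrt_sq (norm_nonneg _)]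
    simp only [hF, Set.indicator, Set.mem_ofPred_eq, Function.comp_apply, h1, h2]
    rw [h3]
  have hrad : ∫ r in Set.Ioi (0 : ℝ),
      r ^ (Module.finrank ℝ (EuclideanSpace ℝ (Fin (d + 1))) - 1) * (r * Real.exp (-r ^ 2))
      = Real.Gamma ((d : ℝ) / 2 + 1) / 2 := by
    have h := integral_rpow_mul_exp_neg_rpow (p := 2) (q := (d : ℝ) + 1) (by norm_num)
      (by linarith [(Nat.cast_nonneg d : (0 : ℝ) ≤ d)])
    rw [show ((d : ℝ) + 1 + 1) / 2 = d / 2 + 1 by ring] at h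
    rw [finrank_euclideanSpace_fin, Nat.add_sub_cancel,
      show Real.Gamma ((d : ℝ) / 2 + 1) / 2 = 1 / 2 * Real.Gamma ((d : ℝ) / 2 + 1) by ring, ← h]
    refine setIntegral_congr_fun measurableSet_Ioi fun r _ => ?_
    have : r ^ ((d : ℝ) + 1) = r ^ (d + 1) := by exact_mod_cast Real.rpow_natCast r (d + 1)
    simp only [this, Real.rpow_ofNat, pow_succ]
    ring
  rw [hgauss, hrad, ← hA, Real.mul_rpow Real.pi_pos.le (by linarith)] at hpolar
  have hpi : Real.pi ^ ((d : ℝ) / 2) = √Real.pi ^ d := by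
    rw [Real.sqrt_eq_rpow, ← Real.rpow_natCast, ← Real.rpow_mul Real.pi_pos.le]
    ring_nf
  have hG : 0 < Real.Gamma ((d : ℝ) / 2 + 1) := Real.Gamma_pos_of_pos (by positivity)
  have hω := surfaceArea_pos d
  rw [stolarskyConstant_eq hd, volume_real_unitBall hd, mul_div_cancel₀ _ hω.ne']
  rw [hpi] at hpolar
  field_simp at hpolar ⊢
  linarith

/-! ### Moments for the normalized measure. -/

instance instIsProbabilityMeasureUniformMeasure (d : ℕ) :
    IsProbabilityMeasure (uniformMeasure d) := by
  refine ⟨?_⟩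
  have h := surfaceArea_pos d
  rw [surfaceArea, Measure.real, ENNReal.toReal_pos_iff] at h
  rw [uniformMeasure, Measure.smul_apply, smul_eq_mul, ENNReal.inv_mul_cancel h.1.ne' h.2.ne]

theorem integral_uniformMeasure {d : ℕ} (f : UnitSphere d → ℝ) :
    ∫ x, f x ∂uniformMeasure d = (surfaceArea d)⁻¹ * ∫ x, f x ∂surfaceMeasure d := by
  rw [uniformMeasure, integral_smul_measure, ENNReal.toReal_inv, smul_eq_mul]
  rfl

theorem integral_cap_inner {d : ℕ} (hd : 0 < d) {t : ℝ} (ht : t ^ 2 < 1) (y : UnitSphere d)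
    (v : EuclideanSpace ℝ (Fin (d + 1))) :
    ∫ x, (cap y t).indicator (fun x => inner ℝ (x : EuclideanSpace ℝ (Fin (d + 1))) v) x
        ∂uniformMeasure d
      = stolarskyConstant d * (1 - t ^ 2) ^ ((d : ℝ) / 2)
        * inner ℝ (y : EuclideanSpace ℝ (Fin (d + 1))) v := by
  have hy : ‖(y : EuclideanSpace ℝ (Fin (d + 1)))‖ = 1 := norm_eq_of_mem_sphere y
  have h := integral_cap_inner_toSphere (y : EuclideanSpace ℝ (Fin (d + 1))) v hy t
  have h2 := integral_cap_pole hd ht hy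
  have hω := surfaceArea_pos d
  rw [integral_uniformMeasure]
  simp only [cap, ge_iff_le]
  unfold surfaceMeasure at h2 ⊢
  rw [h, h2]
  field_simp

theorem integral_inner_sq {d : ℕ} (v : EuclideanSpace ℝ (Fin (d + 1))) :
    ∫ x : UnitSphere d, inner ℝ (x : EuclideanSpace ℝ (Fin (d + 1))) v ^ 2 ∂uniformMeasure d
      = ‖v‖ ^ 2 / (d + 1) := by
  have h := integral_inner_sq_toSphere v
  have hω := surfaceArea_pos d
  rw [finrank_euclideanSpace_fin] at h
  change _ = ‖v‖ ^ 2 * surfaceArea d at h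
  push_cast at h
  rw [integral_uniformMeasure, surfaceMeasure]
  field_simp
  linarith

theorem measurePreserving_uniformMeasure_sphereMap {d : ℕ}
    (L : EuclideanSpace ℝ (Fin (d + 1)) ≃ₗᵢ[ℝ] EuclideanSpace ℝ (Fin (d + 1))) :
    MeasurePreserving (sphereMap L) (uniformMeasure d) (uniformMeasure d) :=
  (measurePreserving_sphereMap L).smul_measure _

theorem measurableSet_cap {d : ℕ} (x : UnitSphere d) (t : ℝ) : MeasurableSet (cap x t) :=
  measurableSet_le measurable_const (by fun_prop)

theorem measurable_cap_measure (d : ℕ) :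
    Measurable fun q : ℝ × UnitSphere d => (uniformMeasure d).real (cap q.2 q.1) := by
  refine (measurable_measure_prodMk_left (ν := uniformMeasure d)
    (s := {q : (ℝ × UnitSphere d) × UnitSphere d | q.1.1 ≤
      inner ℝ (q.2 : EuclideanSpace ℝ (Fin (d + 1))) (q.1.2 : EuclideanSpace ℝ (Fin (d + 1)))})
    (measurableSet_le (by fun_prop) (by fun_prop))).ennreal_toReal

/-- By antipodal symmetry the measure of a cap is orthogonal to the linear functions. -/
theorem integral_cap_measure_mul_inner {d : ℕ} (t : ℝ) (v : EuclideanSpace ℝ (Fin (d + 1))) :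
    ∫ x : UnitSphere d, (uniformMeasure d).real (cap x t)
      * inner ℝ (x : EuclideanSpace ℝ (Fin (d + 1))) v ∂uniformMeasure d = 0 := by
  set N := LinearIsometryEquiv.neg ℝ (E := EuclideanSpace ℝ (Fin (d + 1)))
  have hmp := measurePreserving_uniformMeasure_sphereMap N
  have hcap : ∀ x : UnitSphere d,
      (uniformMeasure d).real (cap (sphereMap N x) t) = (uniformMeasure d).real (cap x t) := by
    intro x
    rw [← hmp.measureReal_preimage (measurableSet_cap _ _).nullMeasurableSet]
    congr 1
    ext z
    simp [cap, N]
  have hmeas : Measurable fun x : UnitSphere d => (uniformMeasure d).real (cap x t)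
      * inner ℝ (x : EuclideanSpace ℝ (Fin (d + 1))) v :=
    ((measurable_cap_measure d).comp (measurable_const.prodMk measurable_id)).mul (by fun_prop)
  have h := integral_map (μ := uniformMeasure d) hmp.measurable.aemeasurable
    hmeas.aestronglyMeasurable
  rw [hmp.map_eq] at h
  simp only [hcap] at h
  simp [N, integral_neg] at h
  linarith

/-! ### Local discrepancy and Bessel's inequality. -/

/-- The local discrepancy of a point set with respect to the cap `C(x, t)`. -/
def localDiscrepancy {d N : ℕ} (p : Fin N → UnitSphere d) (t : ℝ) (x : UnitSphere d) : ℝ :=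
  ({k : Fin N | p k ∈ cap x t}.ncard : ℝ) / (N : ℝ) - (uniformMeasure d).real (cap x t)

/-- Since `p k ∈ cap x t` iff `x ∈ cap (p k) t`, the count becomes a sum of indicators of fixed
caps, which can be integrated in `x`. -/
theorem ncard_eq_sum {d N : ℕ} (p : Fin N → UnitSphere d) (t : ℝ) (x : UnitSphere d) :
    ({k : Fin N | p k ∈ cap x t}.ncard : ℝ) = ∑ k, (cap (p k) t).indicator (fun _ => (1 : ℝ)) x := by
  classical
  rw [Set.ncard_eq_toFinset_card', Finset.card_eq_sum_ones]
  push_cast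
  rw [Set.toFinset_ofPred, Finset.sum_filter]
  refine Finset.sum_congr rfl fun k _ => ?_
  simp [cap, Set.indicator, real_inner_comm]

theorem measurable_localDiscrepancy {d N : ℕ} (p : Fin N → UnitSphere d) :
    Measurable fun q : ℝ × UnitSphere d => localDiscrepancy p q.1 q.2 := by
  unfold localDiscrepancy
  refine Measurable.sub ?_ (measurable_cap_measure d)
  simp only [ncard_eq_sum]
  refine Measurable.div_const (Finset.measurable_fun_sum _ fun k _ => ?_) _
  have hs : MeasurableSet {q : ℝ × UnitSphere d | q.1 ≤
      inner ℝ (q.2 : EuclideanSpace ℝ (Fin (d + 1))) (p k : EuclideanSpace ℝ (Fin (d + 1)))} :=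
    measurableSet_le (by fun_prop) (by fun_prop)
  exact (measurable_const (a := (1 : ℝ))).indicator hs

theorem abs_localDiscrepancy_le {d N : ℕ} (p : Fin N → UnitSphere d) (t : ℝ) (x : UnitSphere d) :
    |localDiscrepancy p t x| ≤ 1 := by
  have h1 : ({k : Fin N | p k ∈ cap x t}.ncard : ℝ) / (N : ℝ) ≤ 1 := by
    refine div_le_one_of_le₀ ?_ (Nat.cast_nonneg _)
    have := Set.ncard_le_ncard (Set.subset_univ {k : Fin N | p k ∈ cap x t})
    rw [Set.ncard_univ, Nat.card_fin] at this
    exact_mod_cast this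
  have h2 : (uniformMeasure d).real (cap x t) ≤ 1 := measureReal_le_one
  have h3 : 0 ≤ (uniformMeasure d).real (cap x t) := measureReal_nonneg
  have h4 : 0 ≤ ({k : Fin N | p k ∈ cap x t}.ncard : ℝ) / (N : ℝ) := by positivity
  rw [localDiscrepancy, abs_le]
  constructor <;> linarith

theorem integrable_inner_uniformMeasure {d : ℕ} (v : EuclideanSpace ℝ (Fin (d + 1))) :
    Integrable (fun x : UnitSphere d => inner ℝ (x : EuclideanSpace ℝ (Fin (d + 1))) v)
      (uniformMeasure d) := by
  refine Integrable.of_bound (C := ‖v‖) (by fun_prop) (.of_forall fun x => ?_)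
  simpa using norm_inner_le_norm (𝕜 := ℝ) (x : EuclideanSpace ℝ (Fin (d + 1))) v

theorem integral_localDiscrepancy_mul_inner {d N : ℕ} (hd : 0 < d) (p : Fin N → UnitSphere d)
    {t : ℝ} (ht : t ^ 2 < 1) (v : EuclideanSpace ℝ (Fin (d + 1))) :
    ∫ x, localDiscrepancy p t x * inner ℝ (x : EuclideanSpace ℝ (Fin (d + 1))) v ∂uniformMeasure d
      = stolarskyConstant d * (1 - t ^ 2) ^ ((d : ℝ) / 2)
        * inner ℝ ((1 / (N : ℝ)) • ∑ j, (p j : EuclideanSpace ℝ (Fin (d + 1)))) v := by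
  have hexp : ∀ x : UnitSphere d,
      localDiscrepancy p t x * inner ℝ (x : EuclideanSpace ℝ (Fin (d + 1))) v
      = 1 / (N : ℝ) * (∑ k, (cap (p k) t).indicator
          (fun x => inner ℝ (x : EuclideanSpace ℝ (Fin (d + 1))) v) x)
        - (uniformMeasure d).real (cap x t) * inner ℝ (x : EuclideanSpace ℝ (Fin (d + 1))) v := by
    intro x
    rw [localDiscrepancy, ncard_eq_sum, sub_mul, div_mul_eq_mul_div, Finset.sum_mul]
    rw [one_div, div_eq_inv_mul]
    congr 3 with k
    simp [Set.indicator]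
  have hi : ∀ k, Integrable ((cap (p k) t).indicator
      fun x : UnitSphere d => inner ℝ (x : EuclideanSpace ℝ (Fin (d + 1))) v) (uniformMeasure d) :=
    fun k => (integrable_inner_uniformMeasure v).indicator (measurableSet_cap _ _)
  have hi2 : Integrable (fun x : UnitSphere d => (uniformMeasure d).real (cap x t)
      * inner ℝ (x : EuclideanSpace ℝ (Fin (d + 1))) v) (uniformMeasure d) := by
    refine (integrable_inner_uniformMeasure v).bdd_mul (c := 1)
      ((measurable_cap_measure d).comp
        (measurable_const.prodMk measurable_id)).aestronglyMeasurable (.of_forall fun x => ?_)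
    rw [Real.norm_of_nonneg measureReal_nonneg]
    exact measureReal_le_one
  simp only [hexp]
  rw [integral_sub ((integrable_finsetSum _ fun k _ => hi k).const_mul _) hi2,
    integral_cap_measure_mul_inner, integral_const_mul, integral_finsetSum _ fun k _ => hi k,
    Finset.sum_congr rfl fun k _ => integral_cap_inner hd ht (p k) v,
    real_inner_smul_left, sum_inner, ← Finset.mul_sum]
  ring

/-- Bessel's inequality for the local discrepancy and the spherical harmonics of degree one. -/
theorem le_integral_localDiscrepancy_sq {d N : ℕ} (hd : 0 < d) (p : Fin N → UnitSphere d)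
    {t : ℝ} (ht : t ^ 2 < 1) :
    (d + 1) * stolarskyConstant d ^ 2 * (1 - t ^ 2) ^ d
        * ‖(1 / (N : ℝ)) • ∑ j, (p j : EuclideanSpace ℝ (Fin (d + 1)))‖ ^ 2
      ≤ ∫ x, |localDiscrepancy p t x| ^ 2 ∂uniformMeasure d := by
  have hmoment := integral_localDiscrepancy_mul_inner hd p ht
  generalize (1 / (N : ℝ)) • ∑ j, (p j : EuclideanSpace ℝ (Fin (d + 1))) = m at hmoment ⊢
  obtain ⟨a, ha⟩ : ∃ a, a = stolarskyConstant d * (1 - t ^ 2) ^ ((d : ℝ) / 2) := ⟨_, rfl⟩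
  have ha2 : a ^ 2 = stolarskyConstant d ^ 2 * (1 - t ^ 2) ^ d := by
    rw [ha, mul_pow, ← Real.rpow_mul_natCast (by linarith)]
    simp
  have hmeas : Measurable (localDiscrepancy p t) :=
    Measurable.of_uncurry_left (f := localDiscrepancy p) (measurable_localDiscrepancy p)
  have hf2 : Integrable (fun x => localDiscrepancy p t x ^ 2) (uniformMeasure d) := by
    refine Integrable.of_bound (C := 1) (hmeas.pow_const 2).aestronglyMeasurable
      (.of_forall fun x => ?_)
    rw [norm_pow, Real.norm_eq_abs]
    exact pow_le_one₀ (abs_nonneg _) (abs_localDiscrepancy_le p t x)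
  have hfg : Integrable (fun x : UnitSphere d => localDiscrepancy p t x
      * inner ℝ (x : EuclideanSpace ℝ (Fin (d + 1))) m) (uniformMeasure d) :=
    (integrable_inner_uniformMeasure m).bdd_mul (c := 1) hmeas.aestronglyMeasurable
      (.of_forall fun x => by simpa using abs_localDiscrepancy_le p t x)
  have hg2 : Integrable (fun x : UnitSphere d =>
      inner ℝ (x : EuclideanSpace ℝ (Fin (d + 1))) m ^ 2) (uniformMeasure d) := by
    refine Integrable.of_bound (C := ‖m‖ ^ 2) (by fun_prop) (.of_forall fun x => ?_)
    have h := abs_real_inner_le_norm (x : EuclideanSpace ℝ (Fin (d + 1))) m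
    rw [norm_eq_of_mem_sphere, one_mul] at h
    rw [norm_pow, Real.norm_eq_abs]
    gcongr
  -- With `g = ⟨·, m⟩`, the discrepancy has product `a ‖m‖²` with `g`, while `∫ g² = ‖m‖² / (d +
  -- 1)`; so `(d + 1) a` is the projection coefficient.
  have hpos : 0 ≤ ∫ x : UnitSphere d, (localDiscrepancy p t x
      - (d + 1) * a * inner ℝ (x : EuclideanSpace ℝ (Fin (d + 1))) m) ^ 2 ∂uniformMeasure d :=
    integral_nonneg fun x => sq_nonneg _
  have hexp : ∀ x : UnitSphere d, (localDiscrepancy p t x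
      - (d + 1) * a * inner ℝ (x : EuclideanSpace ℝ (Fin (d + 1))) m) ^ 2
      = localDiscrepancy p t x ^ 2 - 2 * (d + 1) * a * (localDiscrepancy p t x
        * inner ℝ (x : EuclideanSpace ℝ (Fin (d + 1))) m)
        + ((d + 1) * a) ^ 2 * inner ℝ (x : EuclideanSpace ℝ (Fin (d + 1))) m ^ 2 := by
    intro x; ring
  simp only [hexp] at hpos
  rw [integral_add (f := fun x => localDiscrepancy p t x ^ 2 - 2 * (d + 1) * a *
      (localDiscrepancy p t x * inner ℝ (x : EuclideanSpace ℝ (Fin (d + 1))) m))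
      (hf2.sub (hfg.const_mul _)) (hg2.const_mul _),
    integral_sub hf2 (hfg.const_mul _), integral_const_mul, integral_const_mul,
    hmoment, ← ha, integral_inner_sq,
    real_inner_self_eq_norm_sq] at hpos
  have e : ((d + 1) * a) ^ 2 * (‖m‖ ^ 2 / (d + 1)) = (d + 1) * a ^ 2 * ‖m‖ ^ 2 := by
    field_simp
  rw [e] at hpos
  simp only [sq_abs]
  rw [mul_assoc _ (stolarskyConstant d ^ 2), ← ha2]
  linarith

end CapDiscrepancy

end

/-! ### Integration over the height. -/

theorem mainTheorem3 (d : ℕ) (hd : 2 ≤ d) (N : ℕ) (hN : 2 ≤ N)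
    (p : Fin N → CapDiscrepancy.UnitSphere d) :
    Real.sqrt (CapDiscrepancy.stolarskyConstant d / Real.sqrt 2) *
        ‖(1 / (N : ℝ)) • ∑ j : Fin N, (p j : EuclideanSpace ℝ (Fin (d + 1)))‖ ≤
      CapDiscrepancy.capDiscrepancy p := by
  open CapDiscrepancy MeasureTheory in
  have hd0 : 0 < d := by omega
  refine Real.le_sqrt_of_sq_le ?_
  have hC := stolarskyConstant_pos hd0
  rw [mul_pow, Real.sq_sqrt (by positivity)]
  set m := (1 / (N : ℝ)) • ∑ j : Fin N, (p j : EuclideanSpace ℝ (Fin (d + 1)))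
  calc stolarskyConstant d / √2 * ‖m‖ ^ 2
      ≤ ((d + 1) * stolarskyConstant d ^ 2 * ∫ t in (-1 : ℝ)..1, (1 - t ^ 2) ^ d) * ‖m‖ ^ 2 := by
        gcongr
        exact stolarskyConstant_div_sqrt_two_le hd0
    _ = ∫ t in (-1 : ℝ)..1, (d + 1) * stolarskyConstant d ^ 2 * (1 - t ^ 2) ^ d * ‖m‖ ^ 2 := by
        rw [intervalIntegral.integral_mul_const, intervalIntegral.integral_const_mul]
    _ ≤ ∫ t in (-1 : ℝ)..1, ∫ x, |localDiscrepancy p t x| ^ 2 ∂uniformMeasure d := by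
        -- The open interval matters: the pointwise bound requires `t ^ 2 < 1`.
        refine intervalIntegral.integral_mono_on_of_le_Ioo (by norm_num)
          (Continuous.intervalIntegrable (by fun_prop) _ _) ?_ fun t ht => ?_
        · have hm : StronglyMeasurable fun t : ℝ =>
              ∫ x, |localDiscrepancy p t x| ^ 2 ∂uniformMeasure d :=
            StronglyMeasurable.integral_prod_right'
              (f := fun q : ℝ × UnitSphere d => |localDiscrepancy p q.1 q.2| ^ 2)
              ((measurable_localDiscrepancy p).abs.pow_const 2).stronglyMeasurable
          have : IsFiniteMeasure (volume.restrict (Set.uIoc (-1 : ℝ) 1)) := ⟨by simp⟩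
          rw [intervalIntegrable_iff]
          refine Integrable.of_bound (C := 1) hm.aestronglyMeasurable (.of_forall fun t => ?_)
          refine (norm_integral_le_of_norm_le_const (C := 1) (.of_forall fun x => ?_)).trans
            (by simp)
          rw [norm_pow, Real.norm_eq_abs, abs_abs]
          exact pow_le_one₀ (abs_nonneg _) (abs_localDiscrepancy_le p t x)
        · exact le_integral_localDiscrepancy_sq hd0 p (by nlinarith [ht.1, ht.2])
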